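/- Let $n\ge 0$, $m\ge 0$ be integers and identify $\mathbb R^{2n+2}\simeq\mathbb C^{n+1}$, with Euclidean metric $g_{\mathbb R}$, complex structure $J_{\mathbb R}(\mathbf z)=-i\mathbf z$, and symplectic form $\omega_{\mathbb R}=\sum_j dx_j\wedge dy_j=g_{\mathbb R}(\cdot,J_{\mathbb R}\,\cdot)$. Put $r=|\mathbf z|$, $\mathbf T(\mathbf z)=i\mathbf z$, and let $\theta=r^{-2}\sum_j(x_j\,dy_j-y_j\,dx_j)=r^{-2}g_{\mathbb R}(\mathbf T,\cdot)$. Let $\mathbb S^{2n+1}\subset\mathbb R^{2n+2}$ be the unit sphere with the induced round metric $g_{\mathbb S}$ and let $\mathbb B^{2n+2}$ be the open unit ball. An $m$-dimensional submanifold $\Gamma\subset\mathbb S^{2n+1}$ is *horizontal* if $T_q\Gamma\subset\mathcal H_q:=\{X\in T_q\mathbb S^{2n+1}:\theta(X)=0\}$ for all $q\in\Gamma$. The *modified Bergman metric* on $\mathbb B^{2n+2}$ is $$g_{\tilde B}=\frac{4}{(1-r^2)^2}\,g_{\mathbb R}+\frac{16r^4}{(1-r^2)^4}\,\theta^2 ,$$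 and its symplectic form is $\omega_{\tilde B}=(\mathcal S^{-1})^*\omega_B$, where $\omega_B=\frac{1}{1-r^2}\omega_{\mathbb R}+\frac{r^2}{(1-r^2)^2}\,r\,dr\wedge\theta$ is the symplectic form of the Bergman metric and $\mathcal S^{-1}(\mathbf z)=\frac{2}{1+|\mathbf z|^2}\mathbf z$ is the inverse of the diffeomorphism $\mathcal S(\mathbf z)=\frac{1}{1+\sqrt{1-|\mathbf z|^2}}\mathbf z$ of $\mathbb B^{2n+2}$. **Corollary.** Let $\Gamma\subset\mathbb S^{2n+1}$ be an embedded $m$-dimensional submanifold of class $C^k$, where $2\le k\le\infty$ or $k=\omega$ (real analytic). Suppose that $\Gamma$ is minimal with respect to $g_{\mathbb S}$ (its mean curvature vector in $(\mathbb S^{2n+1},g_{\mathbb S})$ vanishes) and horizontal. Let $$\Sigma=\{t\mathbf q:\ t\ge 0,\ \mathbf q\in\Gamma\}\cap\mathbb B^{2n+2}$$ be the Euclidean cone over $\Gamma$ with vertex $\mathbf 0$, restricted to the ball. Then $\Sigma\setminus\{\mathbf 0\}$ is an $(m+1)$-dimensional $C^k$ submanifold of $\mathbb B^{2n+2}$ that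 is minimal with respect to $g_{\tilde B}$ (its mean curvature vector in $(\mathbb B^{2n+2},g_{\tilde B})$ vanishes) and isotropic with respect to $\omega_{\tilde B}$ (that is, $\omega_{\tilde B}(u,v)=0$ for all $p\in\Sigma\setminus\{\mathbf 0\}$ and $u,v\in T_p(\Sigma\setminus\{\mathbf 0\})$). -/

import Mathlib

open scoped Topology

noncomputable section

namespace ModifiedBergman

/-! ### Submanifolds of a normed space, and minimality with respect to a metric -/

section General

variable {V : Type*} [NormedAddCommGroup V] [NormedSpace ℝ V]

/-- `φ`, restricted to the open set `U ⊆ ℝᵐ`, is a local `C^k` parametrization of `M`: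
a `C^k` immersion which is a homeomorphism of `U` onto a relatively open subset of `M`. -/
structure IsLocalParam (k : WithTop ℕ∞) (m : ℕ) (M : Set V)
    (φ : EuclideanSpace ℝ (Fin m) → V) (U : Set (EuclideanSpace ℝ (Fin m))) : Prop where
  isOpen : IsOpen U
  contDiffOn : ContDiffOn ℝ k φ U
  injective_fderiv : ∀ x ∈ U, Function.Injective (fderiv ℝ φ x)
  isEmbedding : Topology.IsEmbedding (U.domRestrict φ)
  image_eq : ∃ W : Set V, IsOpen W ∧ φ '' U = M ∩ W

/-- `M` is an (embedded) `m`-dimensional submanifold of `V` of class `C^k`. -/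
def IsSubmanifold (k : WithTop ℕ∞) (m : ℕ) (M : Set V) : Prop :=
  ∀ p ∈ M, ∃ φ U, IsLocalParam k m M φ U ∧ p ∈ φ '' U

/-- The tangent space `T_p M`: the velocities at `p` of curves in `M`. -/
def tangentSpaceAt (M : Set V) (p : V) : Set V :=
  {v | ∃ γ : ℝ → V, γ 0 = p ∧ (∀ᶠ t in 𝓝 (0 : ℝ), γ t ∈ M) ∧ HasDerivAt γ v 0}

/-- Christoffel symbols of the first kind: if `∇` is the Levi-Civita connection of the metric `g`
on an open set of `V` and `X`, `Y` are constant vector fields, this is `g(∇_X Y, Z)` at `p`. -/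
def christoffel (g : V → LinearMap.BilinForm ℝ V) (p X Y Z : V) : ℝ :=
  (1 / 2) * (fderiv ℝ (fun q => g q Y Z) p X + fderiv ℝ (fun q => g q X Z) p Y
    - fderiv ℝ (fun q => g q X Y) p Z)

variable {m : ℕ}

/-- The coordinate vector `∂ᵢφ`. -/
def coordVec (φ : EuclideanSpace ℝ (Fin m) → V) (i : Fin m) (x : EuclideanSpace ℝ (Fin m)) : V :=
  fderiv ℝ φ x (EuclideanSpace.single i 1)

/-- The matrix `g(∂ᵢφ, ∂ⱼφ)` of the first fundamental form. -/
def gramMatrix (g : V → LinearMap.BilinForm ℝ V) (φ : EuclideanSpace ℝ (Fin m) → V)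
    (x : EuclideanSpace ℝ (Fin m)) : Matrix (Fin m) (Fin m) ℝ :=
  Matrix.of fun i j => g (φ x) (coordVec φ i x) (coordVec φ j x)

/-- `g(∇_{∂ᵢφ} ∂ⱼφ, ν)`, with `∇` the Levi-Civita connection of `g`. When `ν` is normal this is
`g(A(∂ᵢφ, ∂ⱼφ), ν)`, with `A` the second fundamental form. -/
def secondFF (g : V → LinearMap.BilinForm ℝ V) (φ : EuclideanSpace ℝ (Fin m) → V)
    (x : EuclideanSpace ℝ (Fin m)) (ν : V) (i j : Fin m) : ℝ :=
  g (φ x) (fderiv ℝ (coordVec φ j) x (EuclideanSpace.single i 1)) ν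
    + christoffel g (φ x) (coordVec φ i x) (coordVec φ j x) ν

/-- `g(H, ν)` for a normal vector `ν`, where `H = ∑ gⁱʲ A(∂ᵢφ, ∂ⱼφ)` is the mean curvature
vector. -/
def meanCurvature (g : V → LinearMap.BilinForm ℝ V) (φ : EuclideanSpace ℝ (Fin m) → V)
    (x : EuclideanSpace ℝ (Fin m)) (ν : V) : ℝ :=
  ∑ i, ∑ j, (gramMatrix g φ x)⁻¹ i j * secondFF g φ x ν i j

/-- Let `g` be a Riemannian metric on a neighbourhood of a submanifold `N` of `V`. The
`m`-dimensional submanifold `M ⊆ N` is minimal in `N` with the metric induced by `g`: at every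
point of `M` its mean curvature vector in `N` is zero, i.e. is orthogonal to all vectors `ν`
tangent to `N` and normal to `M`. Here the Levi-Civita connection of `N` is the tangential part of
the one of `g`, so for such `ν` one may compute with the connection of `g`; the mean curvature
vector does not depend on the local parametrization by which it is computed. -/
def IsMinimalIn (g : V → LinearMap.BilinForm ℝ V) (N : Set V) (m : ℕ) (M : Set V) : Prop :=
  M ⊆ N ∧ ∀ p ∈ M, ∃ φ U, ∃ x ∈ U, IsLocalParam 2 m M φ U ∧ φ x = p ∧
    ∀ ν ∈ tangentSpaceAt N p, (∀ i, g p (coordVec φ i x) ν = 0) → meanCurvature g φ x ν = 0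

/-- `M` is isotropic for the two-form `ω`: `ω` vanishes on all its tangent spaces. -/
def IsIsotropic (ω : V → V → V → ℝ) (M : Set V) : Prop :=
  ∀ p ∈ M, ∀ u ∈ tangentSpaceAt M p, ∀ v ∈ tangentSpaceAt M p, ω p u v = 0

/-- The cone over `Γ` with vertex `0`. -/
def cone (Γ : Set V) : Set V := {z | ∃ t : ℝ, 0 ≤ t ∧ ∃ q ∈ Γ, z = t • q}

end General

/-! ### Structures on `ℂⁿ⁺¹ = ℝ²ⁿ⁺²` -/

/-- `ℂⁿ⁺¹ = ℝ²ⁿ⁺²`; `inner ℝ` is the Euclidean metric `g_ℝ = ∑ (dxⱼ² + dyⱼ²)`. -/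
abbrev C (n : ℕ) : Type := EuclideanSpace ℂ (Fin (n + 1))

variable {n : ℕ}

/-- The Euclidean metric. -/
def euclideanMetric (_z : C n) : LinearMap.BilinForm ℝ (C n) := innerₗ (C n)

/-- `J_ℝ`, with `J_ℝ(∂/∂xⱼ) = -∂/∂yⱼ` and `J_ℝ(∂/∂yⱼ) = ∂/∂xⱼ`. -/
def J (v : C n) : C n := -(Complex.I • v)

/-- `ω_ℝ(u, v) = g_ℝ(u, J_ℝ v)`, that is `∑ dxⱼ ∧ dyⱼ`. -/
def euclideanForm (u v : C n) : ℝ := inner ℝ u (J v)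

/-- `T = ∑ (xⱼ ∂/∂yⱼ - yⱼ ∂/∂xⱼ)`. -/
def T (z : C n) : C n := -J z

/-- The one-form `θ = r⁻² ∑ (xⱼ dyⱼ - yⱼ dxⱼ) = r⁻² g_ℝ(T, ·)`. -/
def theta (z : C n) : C n →ₗ[ℝ] ℝ := (1 / ‖z‖ ^ 2) • innerₗ (C n) (T z)

/-- The one-form `dr`. -/
def dr (z : C n) : C n →ₗ[ℝ] ℝ := (1 / ‖z‖) • innerₗ (C n) z

/-- `S²ⁿ⁺¹`. -/
def sph (n : ℕ) : Set (C n) := Metric.sphere 0 1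

/-- The open unit ball. -/
def ball (n : ℕ) : Set (C n) := Metric.ball 0 1

/-- The contact distribution `H_q = ker θ ∩ T_q S²ⁿ⁺¹`. -/
def contactDistribution (q : C n) : Set (C n) := {v ∈ tangentSpaceAt (sph n) q | theta q v = 0}

/-- `Γ` is horizontal: `T_q Γ ⊆ H_q` for all `q ∈ Γ`. -/
def IsHorizontal (Γ : Set (C n)) : Prop := ∀ q ∈ Γ, tangentSpaceAt Γ q ⊆ contactDistribution q

/-- The modified Bergman metric `4 / (1 - r²)² g_ℝ + 16 r⁴ / (1 - r²)⁴ θ²` on the unit ball. -/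
def modifiedBergmanMetric (z : C n) : LinearMap.BilinForm ℝ (C n) :=
  (4 / (1 - ‖z‖ ^ 2) ^ 2) • innerₗ (C n)
    + (16 * ‖z‖ ^ 4 / (1 - ‖z‖ ^ 2) ^ 4) • LinearMap.BilinForm.linMulLin (theta z) (theta z)

/-- The symplectic form `ω_B = (1 - r²)⁻¹ ω_ℝ + r² (1 - r²)⁻² r dr ∧ θ` of the Bergman metric. -/
def bergmanForm (z u v : C n) : ℝ :=
  1 / (1 - ‖z‖ ^ 2) * euclideanForm u v
    + ‖z‖ ^ 2 / (1 - ‖z‖ ^ 2) ^ 2 * (‖z‖ * (dr z u * theta z v - dr z v * theta z u))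

/-- The inverse `z ↦ 2 z / (1 + |z|²)` of the diffeomorphism
`S : z ↦ z / (1 + √(1 - |z|²))` of the unit ball. -/
def SInv (z : C n) : C n := (2 / (1 + ‖z‖ ^ 2)) • z

/-- The symplectic form `(S⁻¹)^* ω_B` of the modified Bergman metric. -/
def modifiedBergmanForm (z u v : C n) : ℝ :=
  bergmanForm (SInv z) (fderiv ℝ SInv z u) (fderiv ℝ SInv z v)

end ModifiedBergman

end

/-!
If `φ` is a local parametrization of `Γ`, then `(t, x) ↦ t φ(x)` is one of the cone
(`isLocalParam_coneParam`); polar coordinates give the continuity of its inverse.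

Horizontality says that `⟪T φ, dφ w⟫ = 0`. In the derivative of this relation along `v`, the term
`⟪T φ, D²φ(v, w)⟫` is symmetric in `v`, `w` and the term `⟪T dφ v, dφ w⟫` is skew, so both vanish
(`IsLocalParam.inner_TL_fderiv_fderiv`, `IsLocalParam.inner_TL_sndFDeriv`). The tangent space of the
cone at `t φ(x)` is spanned by `φ(x)` and the range of `dφ`, so the cone is isotropic for the
Euclidean form and lies in the kernel of `θ`. Since `S⁻¹` is a radial rescaling, these properties
persist under it, and the modified Bergman form vanishes on the cone
(`modifiedBergmanForm_eq_zero`).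

For minimality, the modified Bergman metric is
`a(r²) ⟪·, ·⟫ + b(r²) ⟪T, ·⟫²`. On the cone the second summand is invisible to the first
fundamental form and to the second derivatives of the parametrization. For tangent vectors `X`, `Y`
and a normal vector `ν`, the Christoffel symbol `g(∇_X Y, ν)` of constant fields vanishes
(`christoffel_modifiedBergmanMetric`), the position vector being tangent to the cone. The first and
second fundamental forms are therefore those of the Euclidean cone up to functions of the radius,
the radial direction contributes nothing, and the mean curvature of the cone in a normal direction
is a multiple of that of `Γ` in the sphere (`meanCurvature_coneParam`).
-/

open Filter

namespace ModifiedBergman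

/-! ### Local parametrizations and tangent spaces -/

section LocalParam

variable {V : Type*} [NormedAddCommGroup V] [NormedSpace ℝ V] {k : WithTop ℕ∞} {m : ℕ} {M : Set V}
  {φ : EuclideanSpace ℝ (Fin m) → V} {U : Set (EuclideanSpace ℝ (Fin m))}
  {x : EuclideanSpace ℝ (Fin m)}

theorem IsLocalParam.contDiffAt (h : IsLocalParam k m M φ U) (hx : x ∈ U) :
    ContDiffAt ℝ k φ x :=
  h.contDiffOn.contDiffAt (h.isOpen.mem_nhds hx)

theorem IsLocalParam.hasFDerivAt (h : IsLocalParam k m M φ U) (hk : 2 ≤ k) (hx : x ∈ U) :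
    HasFDerivAt φ (fderiv ℝ φ x) x :=
  ((h.contDiffAt hx).differentiableAt (by rintro rfl; simp at hk)).hasFDerivAt

theorem IsLocalParam.mem (h : IsLocalParam k m M φ U) (hx : x ∈ U) : φ x ∈ M := by
  obtain ⟨W, -, hW⟩ := h.image_eq
  exact (hW.subset (Set.mem_image_of_mem φ hx)).1

theorem IsLocalParam.hasFDerivAt_fderiv (h : IsLocalParam k m M φ U) (hk : 2 ≤ k) (hx : x ∈ U) :
    HasFDerivAt (fderiv ℝ φ) (fderiv ℝ (fderiv ℝ φ) x) x := by
  have h1 : ContDiffAt ℝ 1 (fderiv ℝ φ) x :=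
    ((h.contDiffAt hx).of_le hk).fderiv_right (m := 1) (by norm_num [one_add_one_eq_two])
  exact (h1.differentiableAt one_ne_zero).hasFDerivAt

theorem IsLocalParam.hasFDerivAt_coordVec (h : IsLocalParam k m M φ U) (hk : 2 ≤ k) (hx : x ∈ U)
    (i : Fin m) : HasFDerivAt (coordVec φ i) (fderiv ℝ (coordVec φ i) x) x :=
  (h.hasFDerivAt_fderiv hk hx).differentiableAt.clm_apply
    (differentiableAt_const _) |>.hasFDerivAt

theorem IsLocalParam.fderiv_coordVec_apply (h : IsLocalParam k m M φ U) (hk : 2 ≤ k) (hx : x ∈ U)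
    (i : Fin m) (v : EuclideanSpace ℝ (Fin m)) :
    fderiv ℝ (coordVec φ i) x v = fderiv ℝ (fderiv ℝ φ) x v (EuclideanSpace.single i 1) := by
  have := (h.hasFDerivAt_fderiv hk hx).clm_apply
    (hasFDerivAt_const (EuclideanSpace.single i (1 : ℝ)) x)
  change HasFDerivAt (coordVec φ i) _ x at this
  rw [this.fderiv]
  simp

theorem IsLocalParam.fderiv_fderiv_comm (h : IsLocalParam k m M φ U) (hk : 2 ≤ k) (hx : x ∈ U)
    (v w : EuclideanSpace ℝ (Fin m)) :
    fderiv ℝ (fderiv ℝ φ) x v w = fderiv ℝ (fderiv ℝ φ) x w v :=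
  (h.contDiffAt hx).isSymmSndFDerivAt (by simpa using hk) v w

theorem IsLocalParam.fderiv_mem_tangentSpaceAt (h : IsLocalParam k m M φ U) (hk : 2 ≤ k)
    (hx : x ∈ U) (v : EuclideanSpace ℝ (Fin m)) :
    fderiv ℝ φ x v ∈ tangentSpaceAt M (φ x) := by
  have hl : HasDerivAt (fun t : ℝ => x + t • v) v 0 := by
    simpa using ((hasDerivAt_id (0 : ℝ)).smul_const v).const_add x
  refine ⟨fun t => φ (x + t • v), by simp, ?_, ?_⟩
  · have hU : ∀ᶠ t in 𝓝 (0 : ℝ), x + t • v ∈ U :=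
      hl.continuousAt.eventually_mem (h.isOpen.mem_nhds (by simpa using hx))
    exact hU.mono fun t ht => h.mem ht
  · have h0 : HasFDerivAt φ (fderiv ℝ φ x) (x + (0 : ℝ) • v) := by
      simpa using h.hasFDerivAt hk hx
    exact h0.comp_hasDerivAt (0 : ℝ) hl

/-- A curve in `M` lifts through the parametrization to a curve `ξ` which is continuous, because
`φ` is an embedding, and Lipschitz at the base point, because `dφ` is injective. Hence the
difference quotients of the curve are asymptotic to elements of the range of `dφ`. -/
theorem IsLocalParam.exists_fderiv_eq (h : IsLocalParam k m M φ U) (hk : 2 ≤ k)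
    (hx : x ∈ U) {w : V} (hw : w ∈ tangentSpaceAt M (φ x)) : ∃ v, fderiv ℝ φ x v = w := by
  obtain ⟨γ, hγ0, hγM, hγ⟩ := hw
  obtain ⟨W, hWo, hW⟩ := h.image_eq
  have hxW : φ x ∈ W := (hW.subset (Set.mem_image_of_mem φ hx)).2
  have hlift : ∀ᶠ s in 𝓝 (0 : ℝ), ∃ u : U, φ u = γ s := by
    have : ∀ᶠ s in 𝓝 (0 : ℝ), γ s ∈ W :=
      hγ.continuousAt.eventually_mem (hWo.mem_nhds (hγ0 ▸ hxW))
    filter_upwards [this, hγM] with s h1 h2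
    obtain ⟨u, hu, hus⟩ := hW.superset ⟨h2, h1⟩
    exact ⟨⟨u, hu⟩, hus⟩
  have : Nonempty U := ⟨⟨x, hx⟩⟩
  obtain ⟨ξ, hξ⟩ := Filter.skolem.1 hlift
  have hξc : Tendsto ξ (𝓝 0) (𝓝 ⟨x, hx⟩) := by
    rw [h.isEmbedding.isInducing.tendsto_nhds_iff]
    have : Tendsto γ (𝓝 0) (𝓝 (φ x)) := hγ0 ▸ hγ.continuousAt.tendsto
    exact this.congr' (hξ.mono fun s hs => hs.symm)
  have hξc' : Tendsto (fun s => (ξ s : EuclideanSpace ℝ (Fin m))) (𝓝 0) (𝓝 x) :=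
    (continuous_subtype_val.tendsto _).comp hξc
  have hd := h.hasFDerivAt hk hx
  obtain ⟨K, hK0, hK⟩ := (fderiv ℝ φ x).toLinearMap.exists_antilipschitzWith
    (LinearMap.ker_eq_bot.2 (h.injective_fderiv x hx))
  have hγO : (fun s => γ s - φ x) =O[𝓝 0] fun s : ℝ => s := by
    simpa [hγ0] using hγ.hasFDerivAt.isBigO_sub
  have hO : (fun s => (ξ s : EuclideanSpace ℝ (Fin m)) - x) =O[𝓝 0] fun s : ℝ => s := by
    have h1 : (fun y => y - x) =O[𝓝 x] fun y => φ y - φ x := by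
      have hr : (fun y => y - x) =O[𝓝 x] fun y => fderiv ℝ φ x (y - x) :=
        Asymptotics.IsBigO.of_bound K (Eventually.of_forall fun y => by
          simpa using hK.le_mul_dist (y - x) 0)
      have ho := hd.isLittleO.trans_isBigO hr
      have := ho.right_isBigO_add
      simpa using hr.trans this
    refine ((h1.comp_tendsto hξc').congr' EventuallyEq.rfl ?_).trans hγO
    exact hξ.mono fun s hs => by simp [hs]
  have ho : (fun s => γ s - φ x - fderiv ℝ φ x (ξ s - x)) =o[𝓝 0] fun s : ℝ => s := by
    refine ((hd.isLittleO.comp_tendsto hξc').trans_isBigO hO).congr' ?_ EventuallyEq.rfl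
    exact hξ.mono fun s hs => by simp [hs]
  have ht : Tendsto (fun s : ℝ => fderiv ℝ φ x (s⁻¹ • (ξ s - x))) (𝓝[≠] 0) (𝓝 w) := by
    have h1 := hasDerivAt_iff_tendsto_slope.1 hγ
    have h2 : Tendsto (fun s : ℝ => s⁻¹ • (γ s - φ x - fderiv ℝ φ x (ξ s - x))) (𝓝[≠] 0) (𝓝 0) :=
      (ho.mono nhdsWithin_le_nhds).tendsto_inv_smul_nhds_zero
    have h3 := h1.sub h2
    rw [sub_zero] at h3
    refine h3.congr fun s => ?_
    simp [slope, hγ0, smul_sub]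
  have hcl : IsClosed ((fderiv ℝ φ x).toLinearMap.range : Set V) :=
    Submodule.closed_of_finiteDimensional _
  exact hcl.mem_of_tendsto ht (Eventually.of_forall fun s => ⟨_, rfl⟩)

end LocalParam

/-! ### The unit sphere and the complex structure -/

section Sphere

variable {n : ℕ}

theorem inner_eq_zero_of_mem_tangentSpaceAt_sph {q v : C n}
    (hv : v ∈ tangentSpaceAt (sph n) q) : inner ℝ q v = 0 := by
  obtain ⟨γ, hγ0, hγM, hγ⟩ := hv
  have h1 : HasDerivAt (fun t => ‖γ t‖ ^ 2) (2 * inner ℝ (γ 0) v) 0 := hγ.norm_sq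
  have h2 : HasDerivAt (fun t => ‖γ t‖ ^ 2) 0 0 :=
    (hasDerivAt_const (0 : ℝ) (1 : ℝ)).congr_of_eventuallyEq
      (hγM.mono fun t ht => by simp [mem_sphere_zero_iff_norm.1 ht])
  have := h1.unique h2
  rw [hγ0] at this
  linarith

theorem hasDerivAt_norm {V : Type*} [NormedAddCommGroup V] [InnerProductSpace ℝ V] {γ : ℝ → V}
    {v : V} {s : ℝ} (hγ : HasDerivAt γ v s) (h0 : γ s ≠ 0) :
    HasDerivAt (fun t => ‖γ t‖) (inner ℝ (γ s) v / ‖γ s‖) s := by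
  have h := hγ.norm_sq.sqrt (by simpa using h0)
  simp only [Real.sqrt_sq (norm_nonneg _)] at h
  convert h using 1
  field_simp

theorem mem_tangentSpaceAt_sph_of_inner_eq_zero {q v : C n} (hq : ‖q‖ = 1)
    (hv : inner ℝ q v = 0) : v ∈ tangentSpaceAt (sph n) q := by
  have hl : HasDerivAt (fun t : ℝ => q + t • v) v 0 := by
    simpa using ((hasDerivAt_id (0 : ℝ)).smul_const v).const_add q
  have hq0 : q ≠ 0 := by rintro rfl; simp at hq
  have hn : HasDerivAt (fun t : ℝ => ‖q + t • v‖) 0 0 := by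
    simpa [hv] using hasDerivAt_norm hl (by simpa using hq0)
  refine ⟨fun t => ‖q + t • v‖⁻¹ • (q + t • v), by simp [hq], ?_, ?_⟩
  · have h0 : ∀ᶠ t : ℝ in 𝓝 0, q + t • v ≠ 0 :=
      hl.continuousAt.eventually_ne (by simpa using hq0)
    filter_upwards [h0] with t ht
    rw [sph, mem_sphere_zero_iff_norm, norm_smul, norm_inv, norm_norm,
      inv_mul_cancel₀ (norm_ne_zero_iff.2 ht)]
  · have := (hn.inv (by simpa using hq0)).smul hl
    simpa only [norm_zero, zero_smul, add_zero, hq, inv_one, one_smul, neg_zero, zero_div,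
      Pi.smul_def', Pi.inv_def] using this

/-- `T` as a continuous linear map. -/
noncomputable def TL (n : ℕ) : C n →L[ℝ] C n := Complex.I • ContinuousLinearMap.id ℝ (C n)

theorem T_eq (z : C n) : T z = TL n z := by simp [T, J, TL]

theorem J_eq (z : C n) : J z = -TL n z := by simp [J, TL]

theorem inner_TL_right (u v : C n) : inner ℝ u (TL n v) = -inner ℝ (TL n u) v := by
  simp only [TL, PiLp.inner_apply, smul_apply, ContinuousLinearMap.id_apply,
    PiLp.smul_apply, ← Finset.sum_neg_distrib]
  refine Finset.sum_congr rfl fun i _ => ?_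
  simp [Complex.inner]
  ring

theorem inner_TL_comm (u v : C n) : inner ℝ (TL n u) v = -inner ℝ (TL n v) u := by
  rw [real_inner_comm, inner_TL_right]

theorem inner_TL_self (u : C n) : inner ℝ (TL n u) u = 0 := by
  linarith [inner_TL_comm u u]

theorem inner_TL_eq_zero_of_theta_eq_zero {q v : C n} (hq : ‖q‖ = 1) (h : theta q v = 0) :
    inner ℝ (TL n q) v = 0 := by
  simpa [theta, hq, T_eq] using h

end Sphere

/-! ### Horizontal submanifolds of the sphere -/

section Horizontal

variable {n m : ℕ} {k : WithTop ℕ∞} {Γ : Set (C n)} {φ : EuclideanSpace ℝ (Fin m) → C n}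
  {U : Set (EuclideanSpace ℝ (Fin m))} {x : EuclideanSpace ℝ (Fin m)}

theorem IsLocalParam.norm_eq_one (h : IsLocalParam k m Γ φ U) (hS : Γ ⊆ sph n) (hx : x ∈ U) :
    ‖φ x‖ = 1 :=
  mem_sphere_zero_iff_norm.1 (hS (h.mem hx))

theorem IsLocalParam.inner_fderiv (h : IsLocalParam k m Γ φ U) (hk : 2 ≤ k) (hS : Γ ⊆ sph n)
    (hx : x ∈ U) (v : EuclideanSpace ℝ (Fin m)) : inner ℝ (φ x) (fderiv ℝ φ x v) = 0 := by
  obtain ⟨γ, h0, hM, hγ⟩ := h.fderiv_mem_tangentSpaceAt hk hx v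
  exact inner_eq_zero_of_mem_tangentSpaceAt_sph ⟨γ, h0, hM.mono fun t ht => hS ht, hγ⟩

theorem IsLocalParam.inner_TL_fderiv (h : IsLocalParam k m Γ φ U) (hk : 2 ≤ k) (hS : Γ ⊆ sph n)
    (hhor : IsHorizontal Γ) (hx : x ∈ U) (v : EuclideanSpace ℝ (Fin m)) :
    inner ℝ (TL n (φ x)) (fderiv ℝ φ x v) = 0 :=
  inner_TL_eq_zero_of_theta_eq_zero (h.norm_eq_one hS hx)
    (hhor _ (h.mem hx) (h.fderiv_mem_tangentSpaceAt hk hx v)).2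

theorem IsLocalParam.inner_TL_fderiv_add (h : IsLocalParam k m Γ φ U) (hk : 2 ≤ k)
    (hS : Γ ⊆ sph n) (hhor : IsHorizontal Γ) (hx : x ∈ U) (v w : EuclideanSpace ℝ (Fin m)) :
    inner ℝ (TL n (φ x)) (fderiv ℝ (fderiv ℝ φ) x v w)
      + inner ℝ (TL n (fderiv ℝ φ x v)) (fderiv ℝ φ x w) = 0 := by
  have h1 : HasFDerivAt (fun y => inner ℝ (TL n (φ y)) (fderiv ℝ φ y w)) _ x :=
    ((TL n).hasFDerivAt.comp x (h.hasFDerivAt hk hx)).inner ℝ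
      ((h.hasFDerivAt_fderiv hk hx).clm_apply (hasFDerivAt_const w x))
  have h2 : HasFDerivAt (fun y => inner ℝ (TL n (φ y)) (fderiv ℝ φ y w))
      (0 : EuclideanSpace ℝ (Fin m) →L[ℝ] ℝ) x :=
    (hasFDerivAt_const (0 : ℝ) x).congr_of_eventuallyEq
      (Filter.eventually_of_mem (h.isOpen.mem_nhds hx) fun y hy =>
        h.inner_TL_fderiv hk hS hhor hy w)
  have := congrArg (fun L => L v) (h1.unique h2)
  simpa using this

/-- A horizontal submanifold is isotropic: the derivative of `⟪T φ, dφ w⟫ = 0` in direction `v` is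
the sum of a term symmetric in `v`, `w` and of the skew term `⟪T dφ v, dφ w⟫`, so that both
vanish. -/
theorem IsLocalParam.inner_TL_fderiv_fderiv (h : IsLocalParam k m Γ φ U) (hk : 2 ≤ k)
    (hS : Γ ⊆ sph n) (hhor : IsHorizontal Γ) (hx : x ∈ U) (v w : EuclideanSpace ℝ (Fin m)) :
    inner ℝ (TL n (fderiv ℝ φ x v)) (fderiv ℝ φ x w) = 0 := by
  have h1 := h.inner_TL_fderiv_add hk hS hhor hx v w
  have h2 := h.inner_TL_fderiv_add hk hS hhor hx w v
  rw [h.fderiv_fderiv_comm hk hx w v] at h2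
  linarith [inner_TL_comm (fderiv ℝ φ x v) (fderiv ℝ φ x w)]

theorem IsLocalParam.inner_TL_sndFDeriv (h : IsLocalParam k m Γ φ U) (hk : 2 ≤ k)
    (hS : Γ ⊆ sph n) (hhor : IsHorizontal Γ) (hx : x ∈ U) (v w : EuclideanSpace ℝ (Fin m)) :
    inner ℝ (TL n (φ x)) (fderiv ℝ (fderiv ℝ φ) x v w) = 0 := by
  linarith [h.inner_TL_fderiv_add hk hS hhor hx v w, h.inner_TL_fderiv_fderiv hk hS hhor hx v w]

end Horizontal

/-! ### Parametrization of the cone -/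

section Cone

variable {n m : ℕ} {k : WithTop ℕ∞} {Γ : Set (C n)} {φ : EuclideanSpace ℝ (Fin m) → C n}
  {U : Set (EuclideanSpace ℝ (Fin m))} {y : EuclideanSpace ℝ (Fin (m + 1))}

/-- The projection `ℝᵐ⁺¹ → ℝᵐ` forgetting the coordinate of index `0`. -/
noncomputable def tailL (m : ℕ) : EuclideanSpace ℝ (Fin (m + 1)) →L[ℝ] EuclideanSpace ℝ (Fin m) :=
  (EuclideanSpace.equiv (Fin m) ℝ).symm.toContinuousLinearMap ∘L
    ContinuousLinearMap.pi fun i => EuclideanSpace.proj i.succ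

@[simp] theorem tailL_apply (y : EuclideanSpace ℝ (Fin (m + 1))) (i : Fin m) :
    tailL m y i = y i.succ := rfl

@[simp] theorem tailL_single_zero (a : ℝ) : tailL m (EuclideanSpace.single 0 a) = 0 := by
  ext i; simp [Fin.succ_ne_zero]

@[simp] theorem tailL_single_succ (i : Fin m) (a : ℝ) :
    tailL m (EuclideanSpace.single i.succ a) = EuclideanSpace.single i a := by
  ext j; simp

/-- The point of `ℝᵐ⁺¹` with coordinate `a.1` of index `0` and remaining coordinates `a.2`. -/
noncomputable def consPt (a : ℝ × EuclideanSpace ℝ (Fin m)) : EuclideanSpace ℝ (Fin (m + 1)) :=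
  WithLp.toLp 2 (Fin.cons a.1 a.2.ofLp)

@[simp] theorem consPt_zero (a : ℝ × EuclideanSpace ℝ (Fin m)) : consPt a 0 = a.1 := rfl

@[simp] theorem tailL_consPt (a : ℝ × EuclideanSpace ℝ (Fin m)) : tailL m (consPt a) = a.2 := rfl

theorem consPt_tailL (y : EuclideanSpace ℝ (Fin (m + 1))) : consPt (y 0, tailL m y) = y := by
  ext i
  cases i using Fin.cases <;> rfl

theorem continuous_consPt : Continuous (consPt (m := m)) := by
  refine (PiLp.continuous_toLp 2 _).comp (continuous_pi fun i => ?_)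
  cases i using Fin.cases with
  | zero => exact continuous_fst
  | succ i => exact (EuclideanSpace.proj i).continuous.comp continuous_snd

/-- The parametrization `(t, x) ↦ t φ(x)` of the cone over the image of `φ`. -/
noncomputable def coneParam (φ : EuclideanSpace ℝ (Fin m) → C n)
    (y : EuclideanSpace ℝ (Fin (m + 1))) : C n :=
  y 0 • φ (tailL m y)

/-- The domain `(0, 1) × U` of `coneParam φ`. -/
def coneDom (U : Set (EuclideanSpace ℝ (Fin m))) : Set (EuclideanSpace ℝ (Fin (m + 1))) :=
  {y | 0 < y 0 ∧ y 0 < 1 ∧ tailL m y ∈ U}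

theorem isOpen_coneDom (hU : IsOpen U) : IsOpen (coneDom U) := by
  have h0 : Continuous fun y : EuclideanSpace ℝ (Fin (m + 1)) => y 0 :=
    (EuclideanSpace.proj (𝕜 := ℝ) (0 : Fin (m + 1))).continuous
  exact (isOpen_lt continuous_const h0).inter
    ((isOpen_lt h0 continuous_const).inter (hU.preimage (tailL m).continuous))

theorem hasFDerivAt_coneParam (h : IsLocalParam k m Γ φ U) (hk : 2 ≤ k) (hy : y ∈ coneDom U) :
    HasFDerivAt (coneParam φ) (y 0 • (fderiv ℝ φ (tailL m y) ∘L tailL m) +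
      (EuclideanSpace.proj (𝕜 := ℝ) (0 : Fin (m + 1))).smulRight (φ (tailL m y))) y :=
  (EuclideanSpace.proj (𝕜 := ℝ) (0 : Fin (m + 1))).hasFDerivAt.smul
    ((h.hasFDerivAt hk hy.2.2).comp y (tailL m).hasFDerivAt)

theorem fderiv_coneParam (h : IsLocalParam k m Γ φ U) (hk : 2 ≤ k) (hy : y ∈ coneDom U)
    (v : EuclideanSpace ℝ (Fin (m + 1))) :
    fderiv ℝ (coneParam φ) y v =
      y 0 • fderiv ℝ φ (tailL m y) (tailL m v) + v 0 • φ (tailL m y) := by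
  simp [(hasFDerivAt_coneParam h hk hy).fderiv]

theorem norm_coneParam (h : IsLocalParam k m Γ φ U) (hS : Γ ⊆ sph n) (hy : y ∈ coneDom U) :
    ‖coneParam φ y‖ = y 0 := by
  rw [coneParam, norm_smul, h.norm_eq_one hS hy.2.2, mul_one, Real.norm_of_nonneg hy.1.le]

theorem coneParam_ne_zero (h : IsLocalParam k m Γ φ U) (hS : Γ ⊆ sph n) (hy : y ∈ coneDom U) :
    coneParam φ y ≠ 0 := by
  rw [← norm_ne_zero_iff, norm_coneParam h hS hy]
  exact hy.1.ne'

theorem inv_norm_smul_coneParam (h : IsLocalParam k m Γ φ U) (hS : Γ ⊆ sph n)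
    (hy : y ∈ coneDom U) : ‖coneParam φ y‖⁻¹ • coneParam φ y = φ (tailL m y) := by
  rw [norm_coneParam h hS hy, coneParam, inv_smul_smul₀ hy.1.ne']

/-- The inverse of `(t, x) ↦ t φ(x)` is given by polar coordinates `z ↦ (|z|, z / |z|)` followed by
the inverse of `φ`, hence is continuous. -/
theorem isEmbedding_coneParam (h : IsLocalParam k m Γ φ U) (hS : Γ ⊆ sph n)
    (hc : ContinuousOn (coneParam φ) (coneDom U)) :
    Topology.IsEmbedding ((coneDom U).domRestrict (coneParam φ)) := by
  let split : coneDom U → ℝ × U := fun y => (y.1 0, ⟨tailL m y.1, y.2.2.2⟩)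
  have hsplit : Topology.IsEmbedding split := by
    refine .of_comp (g := fun a : ℝ × U => consPt (a.1, a.2.1)) ?_ ?_ ?_
    · exact ((EuclideanSpace.proj (𝕜 := ℝ) (0 : Fin (m + 1))).continuous.comp
        continuous_subtype_val).prodMk
        (((tailL m).continuous.comp continuous_subtype_val).subtype_mk _)
    · exact continuous_consPt.comp
        (continuous_fst.prodMk (continuous_subtype_val.comp continuous_snd))
    · convert Topology.IsEmbedding.subtypeVal using 1
      funext y
      exact consPt_tailL y.1
  let f : coneDom U → {z : C n // z ≠ 0} := fun y =>
    ⟨coneParam φ y.1, coneParam_ne_zero h hS y.2⟩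
  have hf : Topology.IsEmbedding f := by
    refine .of_comp (g := fun z => (‖z.1‖, ‖z.1‖⁻¹ • z.1)) ?_ ?_ ?_
    · exact (continuousOn_iff_continuous_domRestrict.1 hc).subtype_mk _
    · have hn : Continuous fun z : {z : C n // z ≠ 0} => ‖z.1‖ := by fun_prop
      exact hn.prodMk ((hn.inv₀ fun z => norm_ne_zero_iff.2 z.2).smul continuous_subtype_val)
    · convert (Topology.IsEmbedding.id.prodMap h.isEmbedding).comp hsplit using 1
      funext y
      exact Prod.ext (norm_coneParam h hS y.2) (inv_norm_smul_coneParam h hS y.2)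
  exact Topology.IsEmbedding.subtypeVal.comp hf

theorem exists_image_coneParam (h : IsLocalParam k m Γ φ U) (hS : Γ ⊆ sph n) :
    ∃ W : Set (C n), IsOpen W ∧
      coneParam φ '' coneDom U = ((cone Γ ∩ ball n) \ {0}) ∩ W := by
  obtain ⟨W, hWo, hW⟩ := h.image_eq
  refine ⟨{0}ᶜ ∩ (fun z => ‖z‖⁻¹ • z) ⁻¹' W, ?_, ?_⟩
  · refine ContinuousOn.isOpen_inter_preimage (fun z hz => ?_) isOpen_compl_singleton hWo
    exact ((continuousAt_id.norm.inv₀ (norm_ne_zero_iff.2 hz)).smul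
      continuousAt_id).continuousWithinAt
  · ext z
    constructor
    · rintro ⟨y, hy, rfl⟩
      have h0 := coneParam_ne_zero h hS hy
      refine ⟨⟨⟨⟨y 0, hy.1.le, _, h.mem hy.2.2, rfl⟩, ?_⟩, h0⟩, h0, ?_⟩
      · rw [ball, mem_ball_zero_iff, norm_coneParam h hS hy]
        exact hy.2.1
      · rw [Set.mem_preimage, inv_norm_smul_coneParam h hS hy]
        exact (hW.subset (Set.mem_image_of_mem φ hy.2.2)).2
    · rintro ⟨⟨⟨⟨t, ht, q, hq, rfl⟩, hb⟩, h0⟩, -, hqW⟩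
      have hq1 : ‖q‖ = 1 := mem_sphere_zero_iff_norm.1 (hS hq)
      have ht0 : t ≠ 0 := by rintro rfl; simp at h0
      have hn : ‖t • q‖ = t := by rw [norm_smul, hq1, mul_one, Real.norm_of_nonneg ht]
      rw [Set.mem_preimage, hn, inv_smul_smul₀ ht0] at hqW
      rw [ball, mem_ball_zero_iff, hn] at hb
      obtain ⟨x, hx, rfl⟩ := hW.superset ⟨hq, hqW⟩
      exact ⟨consPt (t, x), ⟨lt_of_le_of_ne ht ht0.symm, hb, hx⟩, rfl⟩

theorem isLocalParam_coneParam (h : IsLocalParam k m Γ φ U) (hk : 2 ≤ k) (hS : Γ ⊆ sph n) :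
    IsLocalParam k (m + 1) ((cone Γ ∩ ball n) \ {0}) (coneParam φ) (coneDom U) := by
  have hcd : ContDiffOn ℝ k (coneParam φ) (coneDom U) :=
    (EuclideanSpace.proj (𝕜 := ℝ) (0 : Fin (m + 1))).contDiff.contDiffOn.smul
      (h.contDiffOn.comp (tailL m).contDiff.contDiffOn fun y hy => hy.2.2)
  refine ⟨isOpen_coneDom h.isOpen, hcd, fun y hy => ?_,
    isEmbedding_coneParam h hS hcd.continuousOn, exists_image_coneParam h hS⟩
  refine (injective_iff_map_eq_zero _).2 fun v hv => ?_
  rw [fderiv_coneParam h hk hy] at hv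
  have h0 : v 0 = 0 := by
    have := congrArg (inner ℝ (φ (tailL m y))) hv
    simpa [inner_add_right, inner_smul_right, h.inner_fderiv hk hS hy.2.2,
      h.norm_eq_one hS hy.2.2] using this
  have h1 : tailL m v = 0 := by
    rw [h0, zero_smul, add_zero, smul_eq_zero_iff_right hy.1.ne'] at hv
    exact (injective_iff_map_eq_zero _).1 (h.injective_fderiv _ hy.2.2) _ hv
  rw [← consPt_tailL v, h0, h1]
  ext i
  cases i using Fin.cases <;> rfl

theorem consPt_mem_coneDom (h : IsLocalParam k m Γ φ U) (hS : Γ ⊆ sph n) {t : ℝ}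
    {x : EuclideanSpace ℝ (Fin m)} (hx : x ∈ U) (ht : 0 ≤ t) (hb : t • φ x ∈ ball n)
    (h0 : t • φ x ≠ 0) : consPt (t, x) ∈ coneDom U := by
  refine ⟨lt_of_le_of_ne ht ?_, ?_, hx⟩
  · rintro rfl
    simp at h0
  · rwa [ball, mem_ball_zero_iff, norm_smul, h.norm_eq_one hS hx, mul_one,
      Real.norm_of_nonneg ht] at hb

end Cone

/-! ### The modified Bergman metric and its Christoffel symbols -/

section Metric

variable {n : ℕ}

/-- Since `r² θ = ⟪T, ·⟫`, the metric has no singularity at the origin. -/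
theorem modifiedBergmanMetric_apply (z u v : C n) :
    modifiedBergmanMetric z u v = 4 / (1 - ‖z‖ ^ 2) ^ 2 * inner ℝ u v
      + 16 / (1 - ‖z‖ ^ 2) ^ 4 * (inner ℝ (TL n z) u * inner ℝ (TL n z) v) := by
  rcases eq_or_ne z 0 with rfl | hz
  · simp [modifiedBergmanMetric]
  · have hz' : ‖z‖ ≠ 0 := norm_ne_zero_iff.2 hz
    simp only [modifiedBergmanMetric, theta, T_eq, LinearMap.add_apply, LinearMap.smul_apply,
      LinearMap.BilinForm.linMulLin_apply, innerₗ_apply_apply, smul_eq_mul]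
    field_simp

theorem one_sub_norm_sq_ne_zero {z : C n} (hz : z ∈ ball n) : 1 - ‖z‖ ^ 2 ≠ 0 := by
  have h1 : ‖z‖ < 1 := mem_ball_zero_iff.1 hz
  nlinarith [norm_nonneg z]

theorem exists_fderiv_modifiedBergmanMetric {p : C n} (hp : p ∈ ball n) :
    ∃ A B D : ℝ, ∀ X Y Z : C n, fderiv ℝ (fun q => modifiedBergmanMetric q Y Z) p X =
      A * inner ℝ p X * inner ℝ Y Z
        + B * inner ℝ p X * (inner ℝ (TL n p) Y * inner ℝ (TL n p) Z)
        + D * (inner ℝ (TL n X) Y * inner ℝ (TL n p) Z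
          + inner ℝ (TL n p) Y * inner ℝ (TL n X) Z) := by
  have hp0 := one_sub_norm_sq_ne_zero hp
  have hr : HasFDerivAt (fun q : C n => ‖q‖ ^ 2) _ p := (hasFDerivAt_id p).norm_sq
  obtain ⟨a, ha⟩ : ∃ a, HasDerivAt (fun s : ℝ => 4 / (1 - s) ^ 2) a (‖p‖ ^ 2) :=
    ⟨_, DifferentiableAt.hasDerivAt (by fun_prop (disch := exact pow_ne_zero 2 hp0))⟩
  obtain ⟨b, hb⟩ : ∃ b, HasDerivAt (fun s : ℝ => 16 / (1 - s) ^ 4) b (‖p‖ ^ 2) :=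
    ⟨_, DifferentiableAt.hasDerivAt (by fun_prop (disch := exact pow_ne_zero 4 hp0))⟩
  refine ⟨2 * a, 2 * b, 16 / (1 - ‖p‖ ^ 2) ^ 4, fun X Y Z => ?_⟩
  have hT : ∀ Y, HasFDerivAt (fun q => inner ℝ (TL n q) Y) _ p := fun Y =>
    (TL n).hasFDerivAt.inner ℝ (hasFDerivAt_const Y p)
  have h := ((ha.comp_hasFDerivAt p hr).mul_const (inner ℝ Y Z)).add
    ((hb.comp_hasFDerivAt p hr).mul ((hT Y).mul (hT Z)))
  have h' := h.congr_of_eventuallyEq (f₁ := fun q => modifiedBergmanMetric q Y Z)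
    (Eventually.of_forall fun q => modifiedBergmanMetric_apply q Y Z)
  rw [h'.fderiv]
  simp
  ring

/-- The only terms of the Christoffel symbol that survive the orthogonality relations come from
differentiating `T` in the factor `⟪T, ·⟫²`; they are skew in `X`, `Y` and cancel. -/
theorem christoffel_modifiedBergmanMetric {p X Y ν : C n} (hp : p ∈ ball n)
    (hX : inner ℝ (TL n p) X = 0) (hY : inner ℝ (TL n p) Y = 0) (hpν : inner ℝ p ν = 0)
    (hXν : inner ℝ X ν = 0) (hYν : inner ℝ Y ν = 0) :
    christoffel modifiedBergmanMetric p X Y ν = 0 := by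
  obtain ⟨A, B, D, h⟩ := exists_fderiv_modifiedBergmanMetric hp
  rw [christoffel, h, h, h, hX, hY, hpν, hXν, hYν, inner_TL_comm Y X]
  ring

theorem christoffel_euclideanMetric (p X Y Z : C n) :
    christoffel euclideanMetric p X Y Z = 0 := by
  simp [christoffel, euclideanMetric]

end Metric

/-! ### Mean curvature of the cone -/

theorem inv_apply_of_block {m : ℕ} {G : Matrix (Fin (m + 1)) (Fin (m + 1)) ℝ}
    {H : Matrix (Fin m) (Fin m) ℝ} {a c : ℝ} (ha : a ≠ 0) (hc : c ≠ 0) (hH : IsUnit H.det)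
    (h00 : G 0 0 = a) (h0 : ∀ j : Fin m, G 0 j.succ = 0) (h1 : ∀ i : Fin m, G i.succ 0 = 0)
    (h2 : ∀ i j : Fin m, G i.succ j.succ = c * H i j) :
    G⁻¹ = Matrix.of (Fin.cons (Fin.cons a⁻¹ 0) fun i => Fin.cons 0 fun j => c⁻¹ * H⁻¹ i j) := by
  refine Matrix.inv_eq_right_inv ?_
  ext i j
  rw [Matrix.mul_apply, Fin.sum_univ_succ]
  cases i using Fin.cases with
  | zero =>
    cases j using Fin.cases with
    | zero => simp [h00, h0, ha]
    | succ j => simp [h0, (Fin.succ_ne_zero j).symm]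
  | succ i =>
    cases j using Fin.cases with
    | zero => simp [h1, Fin.succ_ne_zero i]
    | succ j =>
      have := congrFun (congrFun (Matrix.mul_nonsing_inv H hH) i) j
      rw [Matrix.mul_apply] at this
      simp only [h1, h2, Matrix.of_apply, Fin.cons_zero, Fin.cons_succ, zero_mul, zero_add]
      rw [Finset.sum_congr rfl fun l _ => show c * H i l * (c⁻¹ * H⁻¹ l j) = H i l * H⁻¹ l j by
        field_simp, this]
      simp [Matrix.one_apply]

section MeanCurvature

variable {n m : ℕ} {k : WithTop ℕ∞} {Γ : Set (C n)} {φ : EuclideanSpace ℝ (Fin m) → C n}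
  {U : Set (EuclideanSpace ℝ (Fin m))} {y : EuclideanSpace ℝ (Fin (m + 1))}
  {x : EuclideanSpace ℝ (Fin m)}

theorem IsLocalParam.isUnit_det_gramMatrix (h : IsLocalParam k m Γ φ U) (hx : x ∈ U) :
    IsUnit (gramMatrix euclideanMetric φ x).det := by
  have hli : LinearIndependent ℝ fun i => coordVec φ i x := by
    have := (EuclideanSpace.basisFun (Fin m) ℝ).toBasis.linearIndependent.map'
      (fderiv ℝ φ x).toLinearMap (LinearMap.ker_eq_bot.2 (h.injective_fderiv x hx))
    simpa [Function.comp_def] using! this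
  exact (Matrix.posDef_gram_of_linearIndependent hli).det_pos.ne'.isUnit

theorem coordVec_coneParam_zero (h : IsLocalParam k m Γ φ U) (hk : 2 ≤ k) (hy : y ∈ coneDom U) :
    coordVec (coneParam φ) 0 y = φ (tailL m y) := by
  simp [coordVec, fderiv_coneParam h hk hy]

theorem coordVec_coneParam_succ (h : IsLocalParam k m Γ φ U) (hk : 2 ≤ k) (hy : y ∈ coneDom U)
    (i : Fin m) : coordVec (coneParam φ) i.succ y = y 0 • coordVec φ i (tailL m y) := by
  simp [coordVec, fderiv_coneParam h hk hy, (Fin.succ_ne_zero i).symm]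

theorem fderiv_coordVec_coneParam_zero (h : IsLocalParam k m Γ φ U) (hk : 2 ≤ k)
    (hy : y ∈ coneDom U) :
    fderiv ℝ (coordVec (coneParam φ) 0) y (EuclideanSpace.single 0 1) = 0 := by
  have h1 := ((h.hasFDerivAt hk hy.2.2).comp y (tailL m).hasFDerivAt).congr_of_eventuallyEq
    (f₁ := coordVec (coneParam φ) 0) (Filter.eventually_of_mem
      ((isOpen_coneDom h.isOpen).mem_nhds hy) fun z hz => coordVec_coneParam_zero h hk hz)
  simp [h1.fderiv]

theorem fderiv_coordVec_coneParam_succ (h : IsLocalParam k m Γ φ U) (hk : 2 ≤ k)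
    (hy : y ∈ coneDom U) (i j : Fin m) :
    fderiv ℝ (coordVec (coneParam φ) j.succ) y (EuclideanSpace.single i.succ 1) =
      y 0 • fderiv ℝ (coordVec φ j) (tailL m y) (EuclideanSpace.single i 1) := by
  have h1 := ((EuclideanSpace.proj (𝕜 := ℝ) (0 : Fin (m + 1))).hasFDerivAt (x := y)).smul
    ((h.hasFDerivAt_coordVec hk hy.2.2 j).comp y (tailL m).hasFDerivAt)
  have h2 := h1.congr_of_eventuallyEq
    (f₁ := coordVec (coneParam φ) j.succ) (Filter.eventually_of_mem
      ((isOpen_coneDom h.isOpen).mem_nhds hy) fun z hz => coordVec_coneParam_succ h hk hz j)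
  simp [h2.fderiv, (Fin.succ_ne_zero i).symm]

/-- The radial direction is orthogonal to the others and contributes nothing to the mean curvature,
since rays have no acceleration normal to the cone; along `Γ`, the first and second fundamental
forms of the cone are the Euclidean ones of `Γ` up to factors depending on the radius only. -/
theorem meanCurvature_coneParam (h : IsLocalParam k m Γ φ U) (hk : 2 ≤ k) (hS : Γ ⊆ sph n)
    (hhor : IsHorizontal Γ) (hy : y ∈ coneDom U) {ν : C n}
    (hν0 : inner ℝ (φ (tailL m y)) ν = 0)
    (hν : ∀ i, inner ℝ (coordVec φ i (tailL m y)) ν = 0) :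
    meanCurvature modifiedBergmanMetric (coneParam φ) y ν =
      (y 0)⁻¹ * meanCurvature euclideanMetric φ (tailL m y) ν := by
  set x := tailL m y with hxdef
  set p := coneParam φ y with hp
  have hx : x ∈ U := hy.2.2
  have ht : y 0 ≠ 0 := hy.1.ne'
  have hpt : p = y 0 • φ x := rfl
  have hpb : p ∈ ball n := by
    rw [ball, mem_ball_zero_iff, norm_coneParam h hS hy]
    exact hy.2.1
  set a : ℝ := 4 / (1 - ‖p‖ ^ 2) ^ 2 with ha
  have ha0 : a ≠ 0 := div_ne_zero four_ne_zero (pow_ne_zero 2 (one_sub_norm_sq_ne_zero hpb))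
  have hTq : inner ℝ (TL n p) (φ x) = 0 := by
    simp [hpt, inner_smul_left, inner_TL_self]
  have hTi : ∀ i, inner ℝ (TL n p) (coordVec φ i x) = 0 := fun i => by
    simp [hpt, inner_smul_left, coordVec, h.inner_TL_fderiv hk hS hhor hx]
  have hTij : ∀ i j, inner ℝ (TL n p) (fderiv ℝ (coordVec φ j) x (EuclideanSpace.single i 1)) = 0 :=
    fun i j => by
      simp [hpt, inner_smul_left, h.fderiv_coordVec_apply hk hx,
        h.inner_TL_sndFDeriv hk hS hhor hx]
  have hpν : inner ℝ p ν = 0 := by simp [hpt, inner_smul_left, hν0]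
  have hqi : ∀ i, inner ℝ (φ x) (coordVec φ i x) = 0 := fun i => h.inner_fderiv hk hS hx _
  have hiq : ∀ i, inner ℝ (coordVec φ i x) (φ x) = 0 := fun i => by
    rw [real_inner_comm, hqi]
  have hinv := inv_apply_of_block (G := gramMatrix modifiedBergmanMetric (coneParam φ) y)
    (H := gramMatrix euclideanMetric φ x) (a := a) (c := a * y 0 ^ 2) ha0
    (mul_ne_zero ha0 (pow_ne_zero 2 ht)) (h.isUnit_det_gramMatrix hx)
    (by simp [gramMatrix, modifiedBergmanMetric_apply, coordVec_coneParam_zero h hk hy, ← hp,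
          ← hxdef, hTq, h.norm_eq_one hS hx, ha])
    (fun j => by
        simp [gramMatrix, modifiedBergmanMetric_apply, coordVec_coneParam_zero h hk hy,
          coordVec_coneParam_succ h hk hy, ← hp, ← hxdef, hTq, inner_smul_right, hqi])
    (fun i => by
        simp [gramMatrix, modifiedBergmanMetric_apply, coordVec_coneParam_zero h hk hy,
          coordVec_coneParam_succ h hk hy, ← hp, ← hxdef, hTq, inner_smul_left, hiq])
    (fun i j => by
        simp only [gramMatrix, Matrix.of_apply, modifiedBergmanMetric_apply,
          coordVec_coneParam_succ h hk hy, ← hp, ← hxdef, inner_smul_right, inner_smul_left, hTi,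
          euclideanMetric, innerₗ_apply_apply, ← ha]
        simp
        ring)
  have h00 : secondFF modifiedBergmanMetric (coneParam φ) y ν 0 0 = 0 := by
    rw [secondFF, fderiv_coordVec_coneParam_zero h hk hy, coordVec_coneParam_zero h hk hy,
      christoffel_modifiedBergmanMetric hpb hTq hTq hpν hν0 hν0]
    simp
  have hss : ∀ i j, secondFF modifiedBergmanMetric (coneParam φ) y ν i.succ j.succ =
      a * y 0 * secondFF euclideanMetric φ x ν i j := fun i j => by
    rw [secondFF, secondFF, fderiv_coordVec_coneParam_succ h hk hy,
      coordVec_coneParam_succ h hk hy, coordVec_coneParam_succ h hk hy,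
      christoffel_modifiedBergmanMetric hpb (by simp [inner_smul_right, ← hxdef, hTi])
        (by simp [inner_smul_right, ← hxdef, hTi]) hpν
        (by simp [inner_smul_left, ← hxdef, hν]) (by simp [inner_smul_left, ← hxdef, hν]),
      christoffel_euclideanMetric, modifiedBergmanMetric_apply]
    simp only [← hp, ← hxdef, inner_smul_right, inner_smul_left, hTij, euclideanMetric,
      innerₗ_apply_apply, ← ha]
    simp
    ring
  simp only [meanCurvature, hinv, Fin.sum_univ_succ, Matrix.of_apply, Fin.cons_zero, Fin.cons_succ,
    h00, hss, Pi.zero_apply, zero_mul, mul_zero, Finset.sum_const_zero, zero_add, Finset.mul_sum]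
  refine Finset.sum_congr rfl fun i _ => Finset.sum_congr rfl fun j _ => ?_
  field_simp

end MeanCurvature

/-! ### The symplectic form -/

section Form

variable {n : ℕ}

theorem exists_fderiv_SInv (z : C n) :
    ∃ c d : ℝ, ∀ u, fderiv ℝ SInv z u = c • u + (d * inner ℝ z u) • z := by
  have hr : HasFDerivAt (fun q : C n => ‖q‖ ^ 2) _ z := (hasFDerivAt_id z).norm_sq
  obtain ⟨a, ha⟩ : ∃ a, HasDerivAt (fun s : ℝ => 2 / (1 + s)) a (‖z‖ ^ 2) :=
    ⟨_, (DifferentiableAt.div (by fun_prop) (by fun_prop) (by positivity)).hasDerivAt⟩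
  refine ⟨2 / (1 + ‖z‖ ^ 2), 2 * a, fun u => ?_⟩
  have h := (ha.comp_hasFDerivAt z hr).smul (hasFDerivAt_id z)
  change HasFDerivAt SInv _ z at h
  rw [h.fderiv]
  simp
  ring_nf

/-- `S⁻¹` maps the span of `z`, `u`, `v` to itself and preserves the line of `z`, so it preserves
the vanishing of `ω_ℝ` and of `θ` on that span. -/
theorem modifiedBergmanForm_eq_zero {z u v : C n} (hu : inner ℝ (TL n z) u = 0)
    (hv : inner ℝ (TL n z) v = 0) (huv : inner ℝ (TL n u) v = 0) :
    modifiedBergmanForm z u v = 0 := by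
  obtain ⟨c, d, h⟩ := exists_fderiv_SInv z
  have hu' : inner ℝ (TL n u) z = 0 := by rw [inner_TL_comm, hu, neg_zero]
  have hθ : ∀ w, inner ℝ (TL n z) w = 0 → theta (SInv z) (fderiv ℝ SInv z w) = 0 := by
    intro w hw
    simp [theta, T_eq, SInv, h, inner_smul_right, inner_add_right, hw,
      inner_TL_self]
  rw [modifiedBergmanForm, bergmanForm, hθ u hu, hθ v hv, euclideanForm, J_eq, inner_neg_right,
    inner_TL_right, h, h]
  simp [inner_smul_left, inner_smul_right, inner_add_left, inner_add_right, hv, huv, hu',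
    inner_TL_self]

end Form

end ModifiedBergman

open ModifiedBergman in
theorem mainTheorem9 (n m : ℕ) (k : WithTop ℕ∞) (hk : 2 ≤ k)
    (Γ : Set (ModifiedBergman.C n))
    (hΓ : ModifiedBergman.IsSubmanifold k m Γ)
    (hmin : ModifiedBergman.IsMinimalIn ModifiedBergman.euclideanMetric
      (ModifiedBergman.sph n) m Γ)
    (hhor : ModifiedBergman.IsHorizontal Γ) :
    ModifiedBergman.IsSubmanifold k (m + 1)
        ((ModifiedBergman.cone Γ ∩ ModifiedBergman.ball n) \ {0}) ∧
      ModifiedBergman.IsMinimalIn ModifiedBergman.modifiedBergmanMetric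
        (ModifiedBergman.ball n) (m + 1)
        ((ModifiedBergman.cone Γ ∩ ModifiedBergman.ball n) \ {0}) ∧
      ModifiedBergman.IsIsotropic ModifiedBergman.modifiedBergmanForm
        ((ModifiedBergman.cone Γ ∩ ModifiedBergman.ball n) \ {0}) := by
  have hS : Γ ⊆ sph n := hmin.1
  refine ⟨?_, ⟨fun z hz => hz.1.2, ?_⟩, ?_⟩
  · rintro z ⟨⟨⟨t, ht, q, hq, rfl⟩, hb⟩, h0⟩
    obtain ⟨φ, U, h, x, hx, rfl⟩ := hΓ q hq
    exact ⟨_, _, isLocalParam_coneParam h hk hS, _, consPt_mem_coneDom h hS hx ht hb h0, rfl⟩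
  · rintro z ⟨⟨⟨t, ht, q, hq, rfl⟩, hb⟩, h0⟩
    -- The mean curvature of `Γ` is known in one `C²` parametrization, so the cone is parametrized by
    -- means of that one rather than by a `C^k` one.
    obtain ⟨φ, U, x, hx, h, rfl, hH⟩ := hmin.2 q hq
    have hy := consPt_mem_coneDom h hS hx ht hb h0
    have ht0 : t ≠ 0 := hy.1.ne'
    refine ⟨_, _, _, hy, isLocalParam_coneParam h le_rfl hS, rfl, fun ν _ hν => ?_⟩
    have ha : (4 : ℝ) / (1 - ‖t • φ x‖ ^ 2) ^ 2 ≠ 0 :=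
      div_ne_zero four_ne_zero (pow_ne_zero 2 (one_sub_norm_sq_ne_zero hb))
    -- Paired with a vector annihilated by `θ`, the metric is conformal to the Euclidean one.
    have key : ∀ w, inner ℝ (TL n (φ x)) w = 0 → modifiedBergmanMetric (t • φ x) w ν = 0 →
        inner ℝ w ν = 0 := by
      intro w hw hwν
      simpa [modifiedBergmanMetric_apply, inner_smul_left, hw, ha] using hwν
    have hν0 : inner ℝ (φ x) ν = 0 := by
      have := hν 0
      rw [coordVec_coneParam_zero h le_rfl hy] at this
      exact key _ (inner_TL_self _) this
    have hνi : ∀ i, inner ℝ (coordVec φ i x) ν = 0 := fun i => by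
      have := hν i.succ
      rw [coordVec_coneParam_succ h le_rfl hy] at this
      have hTi : inner ℝ (TL n (φ x)) (coordVec φ i x) = 0 :=
        h.inner_TL_fderiv le_rfl hS hhor hx _
      have := key _ (by simp [inner_smul_right, hTi]) this
      simpa [inner_smul_left, ht0] using this
    rw [meanCurvature_coneParam h le_rfl hS hhor hy hν0 hνi]
    have := hH ν (mem_tangentSpaceAt_sph_of_inner_eq_zero (h.norm_eq_one hS hx) hν0) hνi
    rw [tailL_consPt, this, mul_zero]
  · rintro z ⟨⟨⟨t, ht, q, hq, rfl⟩, hb⟩, h0⟩ u hu v hv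
    obtain ⟨φ, U, h, x, hx, rfl⟩ := hΓ q hq
    have hy := consPt_mem_coneDom h hS hx ht hb h0
    have hc := isLocalParam_coneParam h hk hS
    -- Tangent vectors of the cone are combinations of `φ x` and of the vectors `dφ w`.
    obtain ⟨u, rfl⟩ := hc.exists_fderiv_eq hk hy hu
    obtain ⟨v, rfl⟩ := hc.exists_fderiv_eq hk hy hv
    have h1 := fun w => h.inner_TL_fderiv hk hS hhor hx w
    have h2 : ∀ w, inner ℝ (TL n (fderiv ℝ φ x w)) (φ x) = 0 := fun w => by
      rw [inner_TL_comm, h1, neg_zero]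
    have h3 := fun w w' => h.inner_TL_fderiv_fderiv hk hS hhor hx w w'
    apply modifiedBergmanForm_eq_zero <;>
      simp [fderiv_coneParam h hk hy, inner_add_left, inner_add_right, inner_smul_left,
        inner_smul_right, inner_TL_self, h1, h2, h3]
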